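/- **Model.** A single-coin public-randomness $n$-party protocol (without setup) is synchronous: party $i$ has an input bit $v_i$; in every round each party tosses one unbiased bit (all coins are independent) and then sends to every party a message consisting of that coin and of an arbitrary further part, which is a function of its view (its input, its coins so far, the messages received in previous rounds). At the end of each round a party may halt with an output bit, as a function of its view. An honest party discards what arrives on a channel in a round unless it is exactly one message. An adversary is adaptive, rushing and computationally unbounded: after each round it chooses (irrevocably) which further parties to corrupt from the next round on, and it chooses the corrupted parties' messages of a round knowing the inputs and all coins tossed so far, including those of this round. It is *locally consistent* if corrupted parties toss their coins honestly and in each round a corrupted party $i$ sends to each party $i'$ either nothing (abort), or a set of messages each of which is the message that the protocol prescribes for $i$ towards $i'$ for the true coins of $i$, for some input bit, and for some choice of incoming messages, each being one of the messages that $i$ really received from the respective party in the respective round, or missing. A party is honest if it is never corrupted. The protocol is *$t$-superb* if, for all inputs and against every such locally consistent adversary corrupting at most $t$ parties, with probability $1$ all honest parties output the same bit (agreement), and if all honest parties have the same input bit then they output that bit (validity). Let $\gamma$ be its second-round halting probability: the largest number such that, for all inputs and under every such locally consistent attack corrupting at most $t$ parties, all honest parties halt within two rounds with probability at least $\gamma$.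 **Theorem.** For every $\varepsilon>0$ there is $c>0$ such that for all sufficiently large $n$ the following holds. Let $t=\lfloor(1/3+\varepsilon)n\rfloor$ and let $\Pi$ be a $t$-superb single-coin $n$-party public-randomness Byzantine agreement protocol. Then its second-round halting probability satisfies $\gamma\le n^{-c}$. -/

import Mathlib

open MeasureTheory

namespace ByzantineAgreement

/-- A single-coin, public-randomness, synchronous `n`-party protocol without setup, with Boolean
inputs and outputs. Rounds are numbered from `0`. In round `j` every party tosses one bit and then
sends to every party a message in `Bool × M`: its round-`j` coin together with an arbitrary message
in `M` that is a function of its view. `none` stands for a missing message.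

* `msg i i' j b r h` is the arbitrary part of the message from `i` to `i'` in round `j`, when
  party `i` has input `b`, its coins of the rounds `0, …, j` are `r`, and `h k a` is what it received
  from party `a` in the round `k < j`.
* `out i j b r h` is the decision of `i` at the end of round `j`, where `h k a` is what it received
  from party `a` in the round `k ≤ j`: `some o` means that it halts with output `o`, and `none` that
  it continues. Only the first decision that is not `none` counts. The message functions are
  arbitrary also after halting, so a party that has halted may well just announce that. -/
structure Protocol (n : ℕ) (M : Type*) where
  msg : (i i' : Fin n) → (j : ℕ) → Bool → (Fin (j + 1) → Bool) →
    (Fin j → Fin n → Option (Bool × M)) → M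
  out : (i : Fin n) → (j : ℕ) → Bool → (Fin (j + 1) → Bool) →
    (Fin (j + 1) → Fin n → Option (Bool × M)) → Option Bool

/-- The coins of an execution: `ω j i` is the bit tossed by party `i` in round `j`. -/
abbrev Coins (n : ℕ) : Type := ℕ → Fin n → Bool

/-- All the coins are independent unbiased bits. -/
noncomputable def coinMeasure (n : ℕ) : Measure (Coins n) :=
  Measure.infinitePi fun _ : ℕ => (PMF.uniformOfFintype (Fin n → Bool)).toMeasure

/-- The coins of all parties in the first `j` rounds. -/
def Coins.before {n : ℕ} (ω : Coins n) (j : ℕ) : Fin j → Fin n → Bool := fun k => ω k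

/-- The coins of party `i` in the first `j` rounds. -/
def Coins.ofParty {n : ℕ} (ω : Coins n) (i : Fin n) (j : ℕ) : Fin j → Bool := fun k => ω k i

/-- The next-message function: the message from `i` to `i'` in round `j` consists of the coin that
`i` tossed in this round and of the part prescribed by `msg`. -/
def Protocol.message {n : ℕ} {M : Type*} (prot : Protocol n M) (i i' : Fin n) (j : ℕ) (b : Bool)
    (r : Fin (j + 1) → Bool) (h : Fin j → Fin n → Option (Bool × M)) : Bool × M :=
  (r (Fin.last j), prot.msg i i' j b r h)

/-- An (unbounded) adaptive rushing adversary. `corrupt j` is the set of parties that are corrupted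
in round `j`; it is chosen after round `j - 1`, so it may depend on the coins of all parties in the
rounds before `j`, and corruption is permanent. `send j r i i'` is the set of messages that the
corrupted party `i` sends to `i'` in round `j`; it may also depend on the coins of round `j`.
The coins are published and the adversary is chosen after the inputs, so everything that has been
sent so far is a function of what the adversary is given. The empty set means that `i` aborts. -/
structure Adversary (n : ℕ) (M : Type*) where
  corrupt : (j : ℕ) → (Fin j → Fin n → Bool) → Finset (Fin n)
  corrupt_mono : ∀ (ω : Coins n) (j : ℕ),
    corrupt j (ω.before j) ⊆ corrupt (j + 1) (ω.before (j + 1))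
  send : (j : ℕ) → (Fin (j + 1) → Fin n → Bool) → Fin n → Fin n → Set (Bool × M)

open Classical in
/-- How an honest party reads what arrives on one of its channels in one round: if this is not
exactly one message, it is discarded. -/
noncomputable def receive {X : Type*} (s : Set X) : Option X :=
  if h : ∃ m, s = {m} then some h.choose else none

section Execution

variable {n : ℕ} {M : Type*}

/-- The set of messages sent from `i` to `i'` in round `j`, in the execution of `prot` with inputs
`v` and coins `ω` under the attack of `A`. -/
noncomputable def sent (prot : Protocol n M) (A : Adversary n M) (v : Fin n → Bool)
    (ω : Coins n) (j : ℕ) (i i' : Fin n) : Set (Bool × M) :=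
  if i ∈ A.corrupt j (ω.before j) then A.send j (ω.before (j + 1)) i i'
  else {prot.message i i' j (v i) (ω.ofParty i (j + 1))
    fun (k : Fin j) a => receive (sent prot A v ω k a i)}
termination_by j
decreasing_by exact k.2

/-- The decision that party `i`, following the protocol, takes at the end of round `j`. -/
noncomputable def decision (prot : Protocol n M) (A : Adversary n M) (v : Fin n → Bool)
    (ω : Coins n) (j : ℕ) (i : Fin n) : Option Bool :=
  prot.out i j (v i) (ω.ofParty i (j + 1))
    fun (k : Fin (j + 1)) a => receive (sent prot A v ω k a i)

/-- Party `i` halts within the first `q` rounds. -/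
def HaltsWithin (prot : Protocol n M) (A : Adversary n M) (v : Fin n → Bool)
    (ω : Coins n) (q : ℕ) (i : Fin n) : Prop :=
  ∃ j < q, decision prot A v ω j i ≠ none

/-- Party `i` eventually halts, with output `b`. -/
def Outputs (prot : Protocol n M) (A : Adversary n M) (v : Fin n → Bool)
    (ω : Coins n) (i : Fin n) (b : Bool) : Prop :=
  ∃ j, decision prot A v ω j i = some b ∧ ∀ k < j, decision prot A v ω k i = none

/-- Party `i` is never corrupted. -/
def Honest (A : Adversary n M) (ω : Coins n) (i : Fin n) : Prop :=
  ∀ j, i ∉ A.corrupt j (ω.before j)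

/-- The adversary never corrupts more than `t` parties. -/
def Adversary.CorruptsAtMost (A : Adversary n M) (t : ℕ) : Prop :=
  ∀ (ω : Coins n) (j : ℕ), (A.corrupt j (ω.before j)).card ≤ t

/-- The adversary is locally consistent: every message that a corrupted party `i` sends is the
message prescribed by the protocol for the coins that `i` really tossed, for some input bit, and for
some choice of incoming messages, each of which is one of the messages that `i` really received from
the party in question in the round in question, or is missing. -/
def LocallyConsistent (prot : Protocol n M) (A : Adversary n M) (v : Fin n → Bool) : Prop :=
  ∀ (ω : Coins n) (j : ℕ) (i i' : Fin n), i ∈ A.corrupt j (ω.before j) →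
    ∀ m ∈ A.send j (ω.before (j + 1)) i i',
      ∃ (b : Bool) (h : Fin j → Fin n → Option (Bool × M)),
        (∀ k a, ∀ x ∈ h k a, x ∈ sent prot A v ω k a i) ∧
        m = prot.message i i' j b (ω.ofParty i (j + 1)) h

/-- Perfect agreement against `t` corruptions: almost surely all honest parties output the same
bit. -/
def PerfectAgreement (prot : Protocol n M) (t : ℕ) : Prop :=
  ∀ (v : Fin n → Bool) (A : Adversary n M), LocallyConsistent prot A v → A.CorruptsAtMost t →
    ∀ᵐ ω ∂coinMeasure n, ∃ b, ∀ i, Honest A ω i → Outputs prot A v ω i b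

/-- Perfect validity against `t` corruptions: almost surely, if all honest parties have the same
input bit, then they all output it. -/
def PerfectValidity (prot : Protocol n M) (t : ℕ) : Prop :=
  ∀ (v : Fin n → Bool) (A : Adversary n M), LocallyConsistent prot A v → A.CorruptsAtMost t →
    ∀ᵐ ω ∂coinMeasure n, ∀ b, (∀ i, Honest A ω i → v i = b) →
      ∀ i, Honest A ω i → Outputs prot A v ω i b

/-- The protocol is `t`-superb. -/
def IsSuperb (prot : Protocol n M) (t : ℕ) : Prop :=
  PerfectAgreement prot t ∧ PerfectValidity prot t

/-- `(t, q, γ)`-halting: under every locally consistent attack that corrupts at most `t` parties, all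
honest parties halt within `q` rounds with probability at least `γ`. -/
def HasHalting (prot : Protocol n M) (t q : ℕ) (γ : ℝ) : Prop :=
  ∀ (v : Fin n → Bool) (A : Adversary n M), LocallyConsistent prot A v → A.CorruptsAtMost t →
    γ ≤ (coinMeasure n).real {ω | ∀ i, Honest A ω i → HaltsWithin prot A v ω q i}

end Execution

end ByzantineAgreement

/-! Split the parties into thirds A, B, C, with input 0 on A and 1 on B, and corrupt C. If C claims
0 to everyone, the execution looks as if only B were faulty, so validity allows no early output 1;
if C claims 1 to everyone, A plays that role and no early output 0 is possible. A rushing adversary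
sees the first coins before it fixes claims and later aborts, so some first coins `r` give
conditional halting probability at least γ against all such choices
(`HasHalting.exists_first_coins`). With `r` fixed, change the claims one (sender, receiver) pair at
a time. By agreement, early outputs 0 and 1 together have density at least γ in the second coins, so
at some pair `e` output 0 has density at least γ/2 before the change and output 1 after it.

By Kahn–Kalai–Linial, a set of inverse polynomial density can be entered from almost every point by
changing the coordinates of a small coalition (`exists_coalition`). Let T consist of such coalitions
for both events and the receiver of `e`, and let T abort in the second round. Parties outside C ∪ T
that see the aborts still halt with density at least γ, and their output ignores the second coins of
T and the view of the receiver of `e`. Move the coins of T into the first event and let T abort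
towards p but not towards q: agreement forces p to output 0. The second event forces 1 from the same
view. The contradiction bounds γ (`halting_le_of_coalition`). -/

/-! ### Logarithmic Sobolev and Falik–Samorodnitsky inequalities. -/

namespace BooleanCube

open Finset
open scoped BigOperators

variable {n : ℕ}

/-- The discrete derivative of a function on the Boolean cube in direction `i`. -/
noncomputable def deriv (i : Fin n) (f : (Fin n → Bool) → ℝ) (x : Fin n → Bool) : ℝ :=
  (f x - f (Function.update x i (!x i))) / 2

lemma expect_succ (f : (Fin (n + 1) → Bool) → ℝ) :
    𝔼 x, f x = (𝔼 y, f (Fin.cons false y) + 𝔼 y, f (Fin.cons true y)) / 2 := by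
  rw [← Fintype.expect_equiv (Fin.consEquiv fun _ => Bool)
    (fun p => f (Fin.cons p.1 p.2)) f (fun _ => rfl), ← Finset.univ_product_univ,
    Finset.expect_product]
  rw [Fintype.expect_eq_sum_div_card]
  simp [add_comm]

lemma deriv_zero_cons_false (f : (Fin (n + 1) → Bool) → ℝ) (y : Fin n → Bool) :
    deriv 0 f (Fin.cons false y) = (f (Fin.cons false y) - f (Fin.cons true y)) / 2 := by
  simp [deriv, Fin.update_cons_zero]

lemma deriv_zero_cons_true (f : (Fin (n + 1) → Bool) → ℝ) (y : Fin n → Bool) :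
    deriv 0 f (Fin.cons true y) = (f (Fin.cons true y) - f (Fin.cons false y)) / 2 := by
  simp [deriv, Fin.update_cons_zero]

lemma deriv_succ_cons (i : Fin n) (f : (Fin (n + 1) → Bool) → ℝ) (b : Bool) (y : Fin n → Bool) :
    deriv i.succ f (Fin.cons b y) = deriv i (fun z => f (Fin.cons b z)) y := by
  simp [deriv, Fin.cons_update]

/-- The logarithmic Sobolev inequality on the two-point space. -/
lemma two_point_entropy_le {a b : ℝ} (ha : 0 ≤ a) (hb : 0 ≤ b) :
    (a * Real.log a + b * Real.log b) / 2 - (a + b) / 2 * Real.log ((a + b) / 2)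
      ≤ (√a - √b) ^ 2 := by
  rcases (add_nonneg ha hb).eq_or_lt with h0 | h0
  · have h1 : a = 0 := by linarith
    have h2 : b = 0 := by linarith
    simp [h1, h2]
  set m := (a + b) / 2 with hm
  have hmpos : 0 < m := by positivity
  -- The tangent to the logarithm at the mean bounds the entropy by (a - b)² / (4m); then (√a + √b)²
  -- ≤ 2(a + b) = 4m.
  have key : ∀ c : ℝ, 0 ≤ c → c * Real.log c ≤ c * (Real.log m + c / m - 1) := by
    intro c hc
    rcases hc.eq_or_lt with rfl | hc
    · simp
    · have := Real.log_le_sub_one_of_pos (div_pos hc hmpos)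
      rw [Real.log_div hc.ne' hmpos.ne'] at this
      exact mul_le_mul_of_nonneg_left (by linarith) hc.le
  have h1 := key a ha
  have h2 := key b hb
  have h3 : (a * (Real.log m + a / m - 1) + b * (Real.log m + b / m - 1)) / 2 - m * Real.log m
      = (a - b) ^ 2 / (4 * m) := by
    have : b = 2 * m - a := by rw [hm]; ring
    rw [this]; field_simp; ring
  have h4 : (a - b) ^ 2 / (4 * m) ≤ (√a - √b) ^ 2 := by
    rw [div_le_iff₀ (by positivity)]
    have e : 4 * m = 2 * (√a ^ 2 + √b ^ 2) := by
      rw [Real.sq_sqrt ha, Real.sq_sqrt hb, hm]; ring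
    have e2 : (a - b) = √a ^ 2 - √b ^ 2 := by rw [Real.sq_sqrt ha, Real.sq_sqrt hb]
    rw [e, e2]
    nlinarith [mul_nonneg (sq_nonneg (√a - √b)) (sq_nonneg (√a - √b))]
  linarith

/-- The reverse triangle inequality in L². It turns the two-point entropy of the norms of the two
halves into the energy in the first direction. -/
lemma sq_sqrt_sub_sqrt_le (g h : (Fin n → Bool) → ℝ) :
    (√(𝔼 x, g x ^ 2) - √(𝔼 x, h x ^ 2)) ^ 2 ≤ 𝔼 x, (g x - h x) ^ 2 := by
  have ha : 0 ≤ 𝔼 x, g x ^ 2 := expect_nonneg fun _ _ => sq_nonneg _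
  have hb : 0 ≤ 𝔼 x, h x ^ 2 := expect_nonneg fun _ _ => sq_nonneg _
  have h1 : 𝔼 x, (g x - h x) ^ 2 = 𝔼 x, g x ^ 2 + 𝔼 x, h x ^ 2 - 2 * 𝔼 x, g x * h x := by
    rw [mul_expect, ← expect_add_distrib, ← expect_sub_distrib]
    exact expect_congr rfl fun x _ => by ring
  have h2 : 𝔼 x, g x * h x ≤ √(𝔼 x, g x ^ 2) * √(𝔼 x, h x ^ 2) := by
    rw [← Real.sqrt_mul ha]
    exact Real.le_sqrt_of_sq_le (expect_mul_sq_le_sq_mul_sq _ _ _)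
  rw [h1, sub_sq, Real.sq_sqrt ha, Real.sq_sqrt hb]
  linarith

/-- The logarithmic Sobolev inequality on the Boolean cube. -/
theorem entropy_sq_le (g : (Fin n → Bool) → ℝ) :
    𝔼 x, g x ^ 2 * Real.log (g x ^ 2) - (𝔼 x, g x ^ 2) * Real.log (𝔼 x, g x ^ 2)
      ≤ 4 * ∑ i, 𝔼 x, deriv i g x ^ 2 := by
  induction n with
  | zero => simp
  | succ n ih =>
    have h0 := ih fun y => g (Fin.cons false y)
    have h1 := ih fun y => g (Fin.cons true y)
    have h2 := two_point_entropy_le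
      (expect_nonneg fun y _ => sq_nonneg (g (Fin.cons false y)) : 0 ≤ 𝔼 y, g (Fin.cons false y) ^ 2)
      (expect_nonneg fun y _ => sq_nonneg (g (Fin.cons true y)) : 0 ≤ 𝔼 y, g (Fin.cons true y) ^ 2)
    have h3 := sq_sqrt_sub_sqrt_le (fun y => g (Fin.cons false y)) fun y => g (Fin.cons true y)
    have h4 : 𝔼 x, deriv 0 g x ^ 2
        = (𝔼 y, (g (Fin.cons false y) - g (Fin.cons true y)) ^ 2) / 4 := by
      rw [expect_succ]
      simp only [deriv_zero_cons_false, deriv_zero_cons_true]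
      rw [← expect_add_distrib, expect_div, expect_div]
      exact expect_congr rfl fun x _ => by ring
    rw [Fin.sum_univ_succ, h4, expect_succ, expect_succ fun x => g x ^ 2]
    have h5 : ∀ i : Fin n, 𝔼 x, deriv i.succ g x ^ 2
        = (𝔼 y, deriv i (fun y => g (Fin.cons false y)) y ^ 2
          + 𝔼 y, deriv i (fun y => g (Fin.cons true y)) y ^ 2) / 2 := by
      intro i
      rw [expect_succ]
      simp only [deriv_succ_cons]
    simp only [h5]
    rw [← sum_div, sum_add_distrib]
    linarith

/-- A Nash type inequality on the Boolean cube. -/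
theorem mul_expect_sq_le (g : (Fin n → Bool) → ℝ) (L : ℝ) :
    L * 𝔼 x, g x ^ 2
      ≤ 4 * ∑ i, 𝔼 x, deriv i g x ^ 2 + Real.exp L * (𝔼 x, |g x|) ^ 2 := by
  have hE : 0 ≤ ∑ i, 𝔼 x, deriv i g x ^ 2 :=
    sum_nonneg fun i _ => expect_nonneg fun _ _ => sq_nonneg _
  have hb0 : 0 ≤ 𝔼 x, |g x| := expect_nonneg fun _ _ => abs_nonneg _
  have ha0 : 0 ≤ 𝔼 x, g x ^ 2 := expect_nonneg fun _ _ => sq_nonneg _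
  rcases ha0.eq_or_lt with ha | ha
  · rw [← ha]; nlinarith [mul_nonneg (Real.exp_pos L).le (sq_nonneg (𝔼 x, |g x|))]
  have hb : 0 < 𝔼 x, |g x| := by
    refine hb0.lt_of_ne fun h => ha.ne' ?_
    have := (expect_eq_zero_iff_of_nonneg fun x _ => abs_nonneg (g x)).1 h.symm
    refine expect_eq_zero fun x hx => ?_
    simp [abs_eq_zero.1 (this x hx)]
  have hlsi := entropy_sq_le g
  set a := 𝔼 x, g x ^ 2
  set b := 𝔼 x, |g x|
  have hs : 0 < a / b := div_pos ha hb
  -- Tangent bound for log |g| at a / b. This is Jensen's inequality for the weight g²; on average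
  -- the two correction terms cancel.
  have hpt : ∀ x, 2 * Real.log (a / b) * g x ^ 2 + 2 * g x ^ 2 - 2 * (a / b) * |g x|
      ≤ g x ^ 2 * Real.log (g x ^ 2) := by
    intro x
    rcases (abs_nonneg (g x)).eq_or_lt with h | h
    · rw [abs_eq_zero.1 h.symm]; simp
    · have h1 := Real.one_sub_inv_le_log_of_pos (div_pos h hs)
      rw [Real.log_div h.ne' hs.ne', inv_div] at h1
      have h2 : Real.log (g x ^ 2) = 2 * Real.log |g x| := by
        rw [← sq_abs, Real.log_pow]; norm_num
      have h3 : g x ^ 2 * (a / b / |g x|) = a / b * |g x| := by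
        rw [← sq_abs]; field_simp
      have h4 := mul_le_mul_of_nonneg_left h1 (sq_nonneg (g x))
      rw [h2]
      nlinarith
  have hsum : 2 * Real.log (a / b) * a + 2 * a - 2 * (a / b) * b
      ≤ 𝔼 x, g x ^ 2 * Real.log (g x ^ 2) := by
    refine le_trans (le_of_eq ?_) (expect_le_expect fun x _ => hpt x)
    rw [expect_sub_distrib, expect_add_distrib, mul_expect, mul_expect, mul_expect]
  have h5 : 2 * (a / b) * b = 2 * a := by field_simp
  have h6 : a * (L + 1) - Real.exp L * b ^ 2 ≤ 2 * Real.log (a / b) * a - a * Real.log a := by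
    have hu : 0 < Real.exp L * b ^ 2 / a := by positivity
    have h7 := Real.log_le_sub_one_of_pos hu
    rw [Real.log_div (by positivity) ha.ne', Real.log_mul (by positivity) (by positivity),
      Real.log_exp, Real.log_pow] at h7
    rw [Real.log_div ha.ne' hb.ne']
    have h8 := mul_le_mul_of_nonneg_left h7 ha.le
    have h9 : a * (Real.exp L * b ^ 2 / a - 1) = Real.exp L * b ^ 2 - a := by field_simp
    rw [h9] at h8
    push_cast at h8
    nlinarith
  nlinarith

/-- The Falik–Samorodnitsky inequality. -/
theorem mul_variance_le (f : (Fin n → Bool) → ℝ) (L : ℝ) :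
    L * (𝔼 x, f x ^ 2 - (𝔼 x, f x) ^ 2)
      ≤ 4 * ∑ i, 𝔼 x, deriv i f x ^ 2 + Real.exp L * ∑ i, (𝔼 x, |deriv i f x|) ^ 2 := by
  induction n with
  | zero => simp
  | succ n ih =>
    set f0 : (Fin n → Bool) → ℝ := fun y => f (Fin.cons false y) with hf0
    set f1 : (Fin n → Bool) → ℝ := fun y => f (Fin.cons true y) with hf1
    -- The variance and the energy in the remaining directions split into those of the average and
    -- of the half-difference. Induction handles the average, whose derivatives have no larger L¹
    -- norms; the Nash inequality handles the half-difference, which is the derivative in direction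
    -- 0 up to sign.
    have h1 := ih fun y => (f0 y + f1 y) / 2
    have h2 := mul_expect_sq_le (fun y => (f0 y - f1 y) / 2) L
    have hd1 : ∀ i y, deriv i (fun y => (f0 y + f1 y) / 2) y = (deriv i f0 y + deriv i f1 y) / 2 := by
      intro i y; simp only [deriv]; ring
    have hd2 : ∀ i y, deriv i (fun y => (f0 y - f1 y) / 2) y = (deriv i f0 y - deriv i f1 y) / 2 := by
      intro i y; simp only [deriv]; ring
    have hz : ∀ F : ℝ → ℝ, (∀ t, F (-t) = F t) →
        𝔼 x, F (deriv 0 f x) = 𝔼 y, F ((f0 y - f1 y) / 2) := by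
      intro F hF
      rw [expect_succ]
      simp only [deriv_zero_cons_false, deriv_zero_cons_true]
      have : ∀ y, F ((f (Fin.cons true y) - f (Fin.cons false y)) / 2)
          = F ((f (Fin.cons false y) - f (Fin.cons true y)) / 2) := fun y => by
        rw [← hF]; congr 1; ring
      simp only [this, hf0, hf1]
      ring
    have hz2 := hz (fun t => t ^ 2) fun t => by simp
    have hza := hz (fun t => |t|) fun t => by simp
    have hs : ∀ i : Fin n, ∀ F : ℝ → ℝ, 𝔼 x, F (deriv i.succ f x)
        = (𝔼 y, F (deriv i f0 y) + 𝔼 y, F (deriv i f1 y)) / 2 := by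
      intro i F
      rw [expect_succ]
      simp only [deriv_succ_cons, hf0, hf1]
    have hen : ∑ i : Fin n, 𝔼 x, deriv i.succ f x ^ 2
        = ∑ i, 𝔼 y, deriv i (fun y => (f0 y + f1 y) / 2) y ^ 2
          + ∑ i, 𝔼 y, deriv i (fun y => (f0 y - f1 y) / 2) y ^ 2 := by
      rw [← sum_add_distrib]
      refine sum_congr rfl fun i _ => ?_
      rw [hs i fun t => t ^ 2]
      simp only [hd1, hd2]
      rw [← expect_add_distrib, ← expect_add_distrib, expect_div]
      exact expect_congr rfl fun x _ => by ring
    have hL1 : ∑ i, (𝔼 y, |deriv i (fun y => (f0 y + f1 y) / 2) y|) ^ 2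
        ≤ ∑ i : Fin n, (𝔼 x, |deriv i.succ f x|) ^ 2 := by
      refine sum_le_sum fun i _ => ?_
      refine pow_le_pow_left₀ (expect_nonneg fun _ _ => abs_nonneg _) ?_ 2
      rw [hs i fun t => |t|, ← expect_add_distrib, expect_div]
      refine expect_le_expect fun x _ => ?_
      rw [hd1, abs_div, abs_two]
      gcongr
      exact abs_add_le _ _
    have hvar : 𝔼 x, f x ^ 2 - (𝔼 x, f x) ^ 2
        = (𝔼 y, ((f0 y + f1 y) / 2) ^ 2 - (𝔼 y, (f0 y + f1 y) / 2) ^ 2)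
          + 𝔼 y, ((f0 y - f1 y) / 2) ^ 2 := by
      have e1 : 𝔼 x, f x = 𝔼 y, (f0 y + f1 y) / 2 := by
        rw [expect_succ, ← expect_add_distrib, expect_div]
      have e2 : 𝔼 x, f x ^ 2 = 𝔼 y, ((f0 y + f1 y) / 2) ^ 2 + 𝔼 y, ((f0 y - f1 y) / 2) ^ 2 := by
        rw [expect_succ, ← expect_add_distrib, ← expect_add_distrib, expect_div]
        exact expect_congr rfl fun x _ => by simp only [hf0, hf1]; ring
      rw [e1, e2]; ring
    rw [hvar, Fin.sum_univ_succ, Fin.sum_univ_succ, hz2, hza, hen]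
    have := mul_le_mul_of_nonneg_left hL1 (Real.exp_pos L).le
    have : 0 ≤ 𝔼 y, ((f0 y - f1 y) / 2) ^ 2 := expect_nonneg fun _ _ => sq_nonneg _
    linarith

end BooleanCube
-- Influences and small controlling coalitions.
namespace BooleanCube

open Finset
open scoped BigOperators

variable {n : ℕ}

/-- The uniform measure of a subset of the Boolean cube. -/
noncomputable def density (A : Set (Fin n → Bool)) : ℝ := 𝔼 x, A.indicator 1 x

/-- The points that the coalition `S` can move into `A`. -/
def reach (S : Finset (Fin n)) (A : Set (Fin n → Bool)) : Set (Fin n → Bool) :=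
  {x | ∃ z ∈ A, ∀ i ∉ S, z i = x i}

lemma density_mono {A B : Set (Fin n → Bool)} (h : A ⊆ B) : density A ≤ density B :=
  expect_le_expect fun x _ => Set.indicator_le_indicator_of_subset h (fun _ => zero_le_one) x

lemma density_nonneg (A : Set (Fin n → Bool)) : 0 ≤ density A :=
  expect_nonneg fun _ _ => Set.indicator_nonneg (fun _ _ => zero_le_one) _

lemma density_empty : density (∅ : Set (Fin n → Bool)) = 0 := by simp [density]

lemma density_univ : density (Set.univ : Set (Fin n → Bool)) = 1 := by simp [density]

lemma density_le_one (A : Set (Fin n → Bool)) : density A ≤ 1 :=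
  (density_mono (Set.subset_univ A)).trans density_univ.le

lemma density_union_le (A B : Set (Fin n → Bool)) : density (A ∪ B) ≤ density A + density B := by
  rw [density, density, density, ← expect_add_distrib]
  refine expect_le_expect fun x _ => ?_
  by_cases hA : x ∈ A <;> by_cases hB : x ∈ B <;> simp [hA, hB]

lemma density_compl (A : Set (Fin n → Bool)) : density Aᶜ = 1 - density A := by
  rw [← density_univ (n := n), density, density, density, ← expect_sub_distrib]
  refine expect_congr rfl fun x _ => ?_
  by_cases hA : x ∈ A <;> simp [hA]

/-- Three sets whose densities sum up to more than `2` intersect. -/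
lemma exists_mem_of_density {A B C : Set (Fin n → Bool)}
    (h : 2 < density A + density B + density C) : ∃ x, x ∈ A ∧ x ∈ B ∧ x ∈ C := by
  by_contra! hne
  have h1 : (Set.univ : Set (Fin n → Bool)) ⊆ Aᶜ ∪ (Bᶜ ∪ Cᶜ) := fun x _ => by
    by_cases hA : x ∈ A
    · by_cases hB : x ∈ B
      · exact Or.inr (Or.inr (hne x hA hB))
      · exact Or.inr (Or.inl hB)
    · exact Or.inl hA
  have h2 := density_mono h1
  have h3 := density_union_le Aᶜ (Bᶜ ∪ Cᶜ)
  have h4 := density_union_le Bᶜ Cᶜ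
  rw [density_univ] at h2
  simp only [density_compl] at h3 h4
  linarith

lemma subset_reach (S : Finset (Fin n)) (A : Set (Fin n → Bool)) : A ⊆ reach S A :=
  fun x hx => ⟨x, hx, fun _ _ => rfl⟩

lemma reach_reach (S T : Finset (Fin n)) (A : Set (Fin n → Bool)) :
    reach S (reach T A) ⊆ reach (S ∪ T) A := by
  rintro x ⟨y, ⟨z, hz, hzy⟩, hyx⟩
  refine ⟨z, hz, fun i hi => ?_⟩
  rw [mem_union, not_or] at hi
  rw [hzy i hi.2, hyx i hi.1]

lemma mem_reach_singleton (i : Fin n) (A : Set (Fin n → Bool)) (x : Fin n → Bool) :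
    x ∈ reach {i} A ↔ x ∈ A ∨ Function.update x i (!x i) ∈ A := by
  constructor
  · rintro ⟨z, hz, hzx⟩
    by_cases h : z i = x i
    · left
      have : z = x := funext fun j => by
        by_cases hj : j = i
        · rw [hj, h]
        · exact hzx j (by simpa using hj)
      rwa [← this]
    · right
      have : z = Function.update x i (!x i) := funext fun j => by
        by_cases hj : j = i
        · subst hj
          rw [Function.update_self]
          exact Bool.eq_not.2 h
        · rw [Function.update_of_ne hj]; exact hzx j (by simpa using hj)
      rwa [← this]
  · rintro (h | h)
    · exact subset_reach _ _ h
    · refine ⟨_, h, fun j hj => ?_⟩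
      rw [Function.update_of_ne (by simpa using hj)]

lemma expect_flip (i : Fin n) (f : (Fin n → Bool) → ℝ) :
    𝔼 x, f (Function.update x i (!x i)) = 𝔼 x, f x := by
  have hinv : Function.Involutive fun x : Fin n → Bool => Function.update x i (!x i) := by
    intro x
    simp
  exact Fintype.expect_equiv hinv.toPerm _ _ fun x => rfl

/-- Both sides are half the probability that flipping coordinate i changes membership in A. -/
lemma expect_abs_deriv_indicator (i : Fin n) (A : Set (Fin n → Bool)) :
    𝔼 x, |deriv i (A.indicator 1) x| = density (reach {i} A) - density A := by
  have h : density A = 𝔼 x, (A.indicator 1 x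
      + A.indicator 1 (Function.update x i (!x i)) : ℝ) / 2 := by
    rw [← expect_div, expect_add_distrib, expect_flip i (A.indicator 1), density]
    ring
  rw [h, density, ← expect_sub_distrib]
  refine expect_congr rfl fun x _ => ?_
  have := mem_reach_singleton i A x
  by_cases h1 : x ∈ A <;> by_cases h2 : Function.update x i (!x i) ∈ A <;>
    simp only [h1, h2, true_or, or_true, or_self, iff_true, iff_false] at this <;>
    norm_num [deriv, h1, h2, this, Set.indicator]

lemma deriv_indicator_sq (i : Fin n) (A : Set (Fin n → Bool)) (x : Fin n → Bool) :
    deriv i (A.indicator 1) x ^ 2 = |deriv i (A.indicator 1) x| / 2 := by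
  by_cases h1 : x ∈ A <;> by_cases h2 : Function.update x i (!x i) ∈ A <;>
    norm_num [deriv, h1, h2, Set.indicator]

/-- The theorem of Kahn, Kalai and Linial: some coordinate has a large influence. -/
theorem exists_influence_ge (hn : 2 ≤ n) (A : Set (Fin n → Bool)) :
    ∃ i, density A * (1 - density A) * (Real.log n / (8 * n))
      ≤ density (reach {i} A) - density A := by
  set V := density A * (1 - density A) with hV
  have hn0 : (0 : ℝ) < n := by positivity
  have hlog : 0 < Real.log n := Real.log_pos (by exact_mod_cast hn)
  have hV0 : 0 ≤ V := mul_nonneg (density_nonneg A) (by linarith [density_le_one A])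
  by_contra! hlt
  set δ := V * (Real.log n / (8 * n)) with hδ
  have hJ0 : ∀ i, 0 ≤ density (reach {i} A) - density A := fun i => by
    linarith [density_mono (subset_reach {i} A)]
  have hVpos : 0 < V := by
    refine hV0.lt_of_ne fun h => ?_
    have := hlt ⟨0, by omega⟩
    have := hJ0 ⟨0, by omega⟩
    simp only [hδ, ← h, zero_mul] at *
    linarith
  -- With L = (log n) / 2 the factor exp L is √n. If all influences were below δ, the right side
  -- would be at most V log n (1/4 + 1/32), less than the left side V (log n) / 2.
  have hmain := mul_variance_le (A.indicator (1 : (Fin n → Bool) → ℝ)) (Real.log n / 2)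
  have hexp : Real.exp (Real.log n / 2) = √n := by
    rw [Real.sqrt_eq_rpow, Real.rpow_def_of_pos hn0]; congr 1; ring
  have hvar : 𝔼 x, A.indicator (1 : (Fin n → Bool) → ℝ) x ^ 2
      - (𝔼 x, A.indicator (1 : (Fin n → Bool) → ℝ) x) ^ 2 = V := by
    have : ∀ x, A.indicator (1 : (Fin n → Bool) → ℝ) x ^ 2 = A.indicator 1 x := fun x => by
      by_cases h : x ∈ A <;> simp [h]
    simp only [this]
    rw [← density, hV]; ring
  have h1 : ∑ i, 𝔼 x, deriv i (A.indicator (1 : (Fin n → Bool) → ℝ)) x ^ 2 ≤ n * (δ / 2) := by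
    refine (sum_le_card_nsmul _ _ (δ / 2) fun i _ => ?_).trans (by simp)
    simp only [deriv_indicator_sq]
    rw [← expect_div, expect_abs_deriv_indicator]
    linarith [hlt i]
  have h2 : ∑ i, (𝔼 x, |deriv i (A.indicator (1 : (Fin n → Bool) → ℝ)) x|) ^ 2 ≤ n * δ ^ 2 := by
    refine (sum_le_card_nsmul _ _ (δ ^ 2) fun i _ => ?_).trans (by simp)
    rw [expect_abs_deriv_indicator]
    exact pow_le_pow_left₀ (hJ0 i) (hlt i).le 2
  rw [hvar, hexp] at hmain
  have hsq : √(n : ℝ) ^ 2 = n := Real.sq_sqrt hn0.le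
  have hsq0 : 0 < √(n : ℝ) := Real.sqrt_pos.2 hn0
  have hlog2 : Real.log n ≤ 2 * √n := by
    have := Real.log_le_sub_one_of_pos hsq0
    rw [Real.log_sqrt hn0.le] at this
    linarith
  have hV1 : V ≤ 1 := by
    rw [hV]; nlinarith [density_nonneg A, density_le_one A]
  have h3 : (n : ℝ) * δ = V * Real.log n / 8 := by rw [hδ]; field_simp
  have h4 : √n * (n * δ ^ 2) = V * Real.log n / 64 * (V * (Real.log n / √n)) := by
    rw [hδ]
    have : (n : ℝ) = √n * √n := by rw [← sq, hsq]
    generalize √(n : ℝ) = s at *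
    generalize Real.log n = l at *
    rw [this]
    field_simp
    ring
  have h5 : V * (Real.log n / √n) ≤ 2 := by
    have : Real.log n / √n ≤ 2 := by rw [div_le_iff₀ hsq0]; exact hlog2
    have h0 : 0 ≤ Real.log n / √n := by positivity
    nlinarith
  have h6 : V * Real.log n / 64 * (V * (Real.log n / √n)) ≤ V * Real.log n / 64 * 2 := by
    gcongr
  have h7 := mul_le_mul_of_nonneg_left h2 hsq0.le
  have h8 : 0 < V * Real.log n := by positivity
  nlinarith

lemma exists_coalition_add_one (hn : 2 ≤ n) (A : Set (Fin n → Bool)) (S : Finset (Fin n)) :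
    ∃ T : Finset (Fin n), T.card ≤ S.card + 1 ∧
      density (reach S A) + density (reach S A) * (1 - density (reach S A)) * (Real.log n / (8 * n))
        ≤ density (reach T A) := by
  obtain ⟨i, hi⟩ := exists_influence_ge hn (reach S A)
  refine ⟨{i} ∪ S, (card_union_le _ _).trans (by simp [add_comm]), ?_⟩
  linarith [density_mono (reach_reach {i} S A)]

lemma reach_empty (A : Set (Fin n → Bool)) : reach ∅ A = A := by
  ext x
  refine ⟨fun ⟨z, hz, hzx⟩ => ?_, fun h => subset_reach _ _ h⟩
  rwa [show x = z from funext fun i => (hzx i (notMem_empty i)).symm]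

/-- Below density 1/2 the complement has density at least 1/2, so each added party multiplies the
density by at least 1 + log n / (16n). -/
lemma exists_coalition_half (hn : 2 ≤ n) (A : Set (Fin n → Bool)) (s : ℕ) :
    ∃ S : Finset (Fin n), S.card ≤ s ∧ (1 / 2 ≤ density (reach S A) ∨
      density A * (1 + Real.log n / (16 * n)) ^ s ≤ density (reach S A)) := by
  have hn0 : (0 : ℝ) < n := by positivity
  have hlog : 0 < Real.log n := Real.log_pos (by exact_mod_cast hn)
  induction s with
  | zero => exact ⟨∅, by simp, Or.inr (by simp [reach_empty])⟩
  | succ s ih =>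
    obtain ⟨S, hS, h⟩ := ih
    rcases le_or_gt (1 / 2) (density (reach S A)) with h2 | h2
    · exact ⟨S, by omega, Or.inl h2⟩
    have h3 := h.resolve_left h2.not_ge
    obtain ⟨T, hT, h4⟩ := exists_coalition_add_one hn A S
    refine ⟨T, by omega, Or.inr ?_⟩
    have hl : 0 < Real.log n / (16 * n) := by positivity
    have hl2 : Real.log n / (8 * n) = 2 * (Real.log n / (16 * n)) := by field_simp; norm_num
    rw [pow_succ, ← mul_assoc]
    refine (mul_le_mul_of_nonneg_right h3 (by positivity)).trans (le_trans ?_ h4)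
    rw [hl2]
    have := density_nonneg (reach S A)
    nlinarith [mul_nonneg this hl.le]

/-- Above density 1/2 each added party shrinks the complement by the factor 1 - log n / (16n). -/
lemma exists_coalition_of_half (hn : 2 ≤ n) (A : Set (Fin n → Bool)) (S₀ : Finset (Fin n))
    (h₀ : 1 / 2 ≤ density (reach S₀ A)) (s : ℕ) :
    ∃ S : Finset (Fin n), S.card ≤ S₀.card + s ∧ 1 / 2 ≤ density (reach S A) ∧
      1 - density (reach S A) ≤ (1 - Real.log n / (16 * n)) ^ s := by
  have hn0 : (0 : ℝ) < n := by positivity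
  have hlog : 0 < Real.log n := Real.log_pos (by exact_mod_cast hn)
  have hle : Real.log n ≤ n := (Real.log_le_sub_one_of_pos hn0).trans (by linarith)
  have hl1 : Real.log n / (16 * n) ≤ 1 := by rw [div_le_one (by positivity)]; linarith
  induction s with
  | zero => exact ⟨S₀, by simp, h₀, by simpa using density_nonneg _⟩
  | succ s ih =>
    obtain ⟨S, hS, h, h'⟩ := ih
    obtain ⟨T, hT, h4⟩ := exists_coalition_add_one hn A S
    have hl : 0 < Real.log n / (16 * n) := by positivity
    have hl2 : Real.log n / (8 * n) = 2 * (Real.log n / (16 * n)) := by field_simp; norm_num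
    rw [hl2] at h4
    have h1 := density_le_one (reach S A)
    have h5 : 0 ≤ (1 - density (reach S A)) * (Real.log n / (16 * n)) :=
      mul_nonneg (by linarith) hl.le
    refine ⟨T, by omega, by nlinarith, ?_⟩
    rw [pow_succ]
    refine le_trans ?_ (mul_le_mul_of_nonneg_right h' (by linarith))
    nlinarith

/-- Every set of inverse polynomial density has a small coalition that controls it almost surely. -/
theorem exists_coalition {η : ℝ} (hη : 0 < η) :
    ∃ c : ℝ, 0 < c ∧ ∃ N : ℕ, ∀ n : ℕ, N ≤ n → ∀ A : Set (Fin n → Bool),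
      (n : ℝ) ^ (-c) / 2 ≤ density A →
        ∃ S : Finset (Fin n), (S.card : ℝ) ≤ η * n ∧ 1 - (n : ℝ) ^ (-c) / 3 ≤ density (reach S A) := by
  obtain ⟨N₁, hN₁⟩ := (((tendsto_rpow_atTop (show 0 < η / 96 by positivity)).comp
    tendsto_natCast_atTop_atTop).eventually_ge_atTop 3).exists_forall_of_atTop
  obtain ⟨N₂, hN₂⟩ := (tendsto_natCast_atTop_atTop (R := ℝ)).eventually_ge_atTop (6 / η)
    |>.exists_forall_of_atTop
  refine ⟨η / 96, by positivity, max 2 (max N₁ N₂), fun n hn A hA => ?_⟩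
  have hn2 : 2 ≤ n := (le_max_left _ _).trans hn
  have h3 : 3 ≤ (n : ℝ) ^ (η / 96) := hN₁ n (by omega)
  have hnη : 6 / η ≤ n := hN₂ n (by omega)
  rw [div_le_iff₀ hη] at hnη
  have hn0 : (0 : ℝ) < n := by positivity
  have hlog : 0 < Real.log n := Real.log_pos (by exact_mod_cast hn2)
  have hle : Real.log n ≤ n := (Real.log_le_sub_one_of_pos hn0).trans (by linarith)
  set l := Real.log n / (16 * n) with hl
  have hl0 : 0 < l := by positivity
  have hl1 : l ≤ 1 := by rw [hl, div_le_one (by positivity)]; linarith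
  -- Two phases of s parties each fit into η n once η n ≥ 6. The first gains a factor n^(η/96), the
  -- second leaves a complement of at most n^(-η/48), the square of n^(-c).
  set s := ⌈η / 3 * n⌉₊ with hs
  have hs1 : η / 3 * n ≤ s := Nat.le_ceil _
  have hs2 : (s : ℝ) < η / 3 * n + 1 := Nat.ceil_lt_add_one (by positivity)
  have hls : η / 48 * Real.log n ≤ l * s := by
    refine le_trans (le_of_eq ?_) (mul_le_mul_of_nonneg_left hs1 hl0.le)
    rw [hl]; field_simp; norm_num
  have hc : (n : ℝ) ^ (-(η / 96)) = Real.exp (-(η / 96 * Real.log n)) := by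
    rw [Real.rpow_def_of_pos hn0]; congr 1; ring
  have hc' : (n : ℝ) ^ (η / 96) = Real.exp (η / 96 * Real.log n) := by
    rw [Real.rpow_def_of_pos hn0]; congr 1; ring
  obtain ⟨S₀, hS₀, h⟩ := exists_coalition_half hn2 A s
  have hhalf : 1 / 2 ≤ density (reach S₀ A) := by
    refine h.elim id fun h => le_trans ?_ h
    have h4 : Real.exp (l / 2) ≤ 1 + l := by
      have := Real.one_sub_inv_le_log_of_pos (show 0 < 1 + l by linarith)
      rw [← Real.le_log_iff_exp_le (by linarith)]
      refine le_trans ?_ this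
      rw [show 1 - (1 + l)⁻¹ = l / (1 + l) by field_simp; ring]
      gcongr
      linarith
    have h5 : Real.exp (η / 96 * Real.log n) ≤ (1 + l) ^ s := by
      refine le_trans ?_ (pow_le_pow_left₀ (Real.exp_pos _).le h4 s)
      rw [← Real.exp_nat_mul, Real.exp_le_exp]
      linarith
    calc (1 : ℝ) / 2 = Real.exp (-(η / 96 * Real.log n)) / 2 * Real.exp (η / 96 * Real.log n) := by
          rw [div_mul_eq_mul_div, ← Real.exp_add]; simp
      _ ≤ density A * (1 + l) ^ s := by
          rw [hc] at hA
          gcongr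
          exact density_nonneg A
  obtain ⟨S, hS, -, h6⟩ := exists_coalition_of_half hn2 A S₀ hhalf s
  refine ⟨S, ?_, ?_⟩
  · have : (S.card : ℝ) ≤ s + s := by exact_mod_cast hS.trans (by omega)
    linarith
  · have h7 : (1 - l) ^ s ≤ Real.exp (-(η / 48 * Real.log n)) := by
      refine (pow_le_pow_left₀ (by linarith) (Real.one_sub_le_exp_neg l) s).trans ?_
      rw [← Real.exp_nat_mul, Real.exp_le_exp]
      linarith
    have h8 : Real.exp (-(η / 48 * Real.log n)) ≤ (n : ℝ) ^ (-(η / 96)) / 3 := by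
      rw [hc, show -(η / 48 * Real.log n) = -(η / 96 * Real.log n) + -(η / 96 * Real.log n) by ring,
        Real.exp_add, div_eq_mul_inv _ (3 : ℝ)]
      refine mul_le_mul_of_nonneg_left ?_ (Real.exp_pos _).le
      rw [Real.exp_neg, ← hc']
      exact inv_anti₀ (by norm_num) h3
    linarith

end BooleanCube
-- Two-round attacks and what they make the parties see.
namespace ByzantineAgreement

section Attack

variable {n : ℕ} {M : Type*}

lemma receive_singleton {X : Type*} (m : X) : receive ({m} : Set X) = some m := by
  have h : ∃ m', ({m} : Set X) = {m'} := ⟨m, rfl⟩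
  rw [receive, dif_pos h, ← Set.singleton_injective h.choose_spec]

lemma receive_empty {X : Type*} : receive (∅ : Set X) = none := by
  rw [receive, dif_neg]
  rintro ⟨m, h⟩
  exact Set.singleton_ne_empty m h.symm

/-- The first message from `a` to `i`, when `a` claims towards `i` the input `w a i`. -/
def firstMsg (prot : Protocol n M) (w : Fin n → Fin n → Bool) (r : Fin n → Bool) (a i : Fin n) :
    Bool × M :=
  prot.message a i 0 (w a i) (fun _ => r a) fun k => k.elim0

/-- The second message from `a` to `i`, when the claims in the first round were `w`, and `a` claims
towards `i` the input that it claimed towards itself. -/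
def secondMsg (prot : Protocol n M) (w : Fin n → Fin n → Bool) (r r' : Fin n → Bool)
    (a i : Fin n) : Bool × M :=
  prot.message a i 1 (w a a) ![r a, r' a] fun _ b => some (firstMsg prot w r b a)

/-- The decision of `i` at the end of the first round, when the claims are `w`. -/
def firstDecision (prot : Protocol n M) (w : Fin n → Fin n → Bool) (i : Fin n)
    (r : Fin n → Bool) : Option Bool :=
  prot.out i 0 (w i i) (fun _ => r i) fun _ a => some (firstMsg prot w r a i)

/-- The decision of `i` at the end of the second round, when the claims are `w` and the parties
in `T` abort in the second round. -/
def secondDecision (prot : Protocol n M) (w : Fin n → Fin n → Bool) (T : Finset (Fin n))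
    (i : Fin n) (r r' : Fin n → Bool) : Option Bool :=
  prot.out i 1 (w i i) ![r i, r' i]
    ![fun a => some (firstMsg prot w r a i),
      fun a => if a ∈ T then none else some (secondMsg prot w r r' a i)]

/-- The output of `i` within the first two rounds. -/
def earlyOutput (prot : Protocol n M) (w : Fin n → Fin n → Bool) (T : Finset (Fin n))
    (i : Fin n) (r r' : Fin n → Bool) : Option Bool :=
  (firstDecision prot w i r).or (secondDecision prot w T i r r')

/-- Nothing from T arrives in the second round, so neither the second coins of T nor the claims made
to T can affect a party outside T. -/
lemma earlyOutput_congr (prot : Protocol n M) {w w' : Fin n → Fin n → Bool} {T : Finset (Fin n)}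
    {i : Fin n} (r : Fin n → Bool) {x y : Fin n → Bool} (hi : i ∉ T)
    (hw : ∀ j ∉ T, ∀ a, w a j = w' a j) (hxy : ∀ j ∉ T, x j = y j) :
    earlyOutput prot w T i r x = earlyOutput prot w' T i r y := by
  have h1 : ∀ j ∉ T, ∀ a, firstMsg prot w r a j = firstMsg prot w' r a j := fun j hj a => by
    simp only [firstMsg, hw j hj]
  have h2 : ∀ a ∉ T, secondMsg prot w r x a i = secondMsg prot w' r y a i := fun a ha => by
    simp only [secondMsg, hw a ha, hxy a ha, h1 a ha]
  have h3 : (fun a => if a ∈ T then none else some (secondMsg prot w r x a i))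
      = fun a => if a ∈ T then none else some (secondMsg prot w' r y a i) := by
    funext a
    split_ifs with ha
    · rfl
    · rw [h2 a ha]
  simp only [earlyOutput, firstDecision, secondDecision, h1 i hi, hw i hi, hxy i hi, h3]

/-- A plan of an attack on the first two rounds. The parties in `start` are corrupted at the outset,
and those in `later r` after the first round, when its coins are `r`. Party `i` is made to believe
that the claims in the first round are `claims r i`, and it receives nothing from the parties in
`abort r i` in the second round. -/
structure Plan (n : ℕ) where
  start : Finset (Fin n)
  later : (Fin n → Bool) → Finset (Fin n)
  start_subset : ∀ r, start ⊆ later r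
  claims : (Fin n → Bool) → Fin n → Fin n → Fin n → Bool
  abort : (Fin n → Bool) → Fin n → Finset (Fin n)

/-- The plan can be carried out when the inputs are `v`. -/
structure Plan.Feasible (P : Plan n) (v : Fin n → Bool) : Prop where
  claims_eq : ∀ r x, ∀ a ∉ P.start, ∀ i, P.claims r x a i = v a
  claims_congr : ∀ r x, ∀ i ∉ P.later r, ∀ a, P.claims r x a i = P.claims r i a i
  abort_subset : ∀ r x, P.abort r x ⊆ P.later r

/-- The adversary that carries out a plan, and aborts after the second round. -/
def Plan.adversary (P : Plan n) (prot : Protocol n M) : Adversary n M where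
  corrupt j := match j with
    | 0 => fun _ => P.start
    | _ + 1 => fun r => P.later (r 0)
  corrupt_mono ω j := by
    cases j with
    | zero => exact P.start_subset _
    | succ j => exact subset_rfl
  send j := match j with
    -- All versions are sent at once. They coincide for a receiver that stays honest; one that is
    -- corrupted afterwards may pretend to have received any of them, consistently with its real
    -- messages.
    | 0 => fun r a i => {m | ∃ x, m = firstMsg prot (P.claims (r 0) x) (r 0) a i}
    | 1 => fun r a i =>
      {m | a ∉ P.abort (r 0) i ∧ m = secondMsg prot (P.claims (r 0) i) (r 0) (r 1) a i}
    | _ + 2 => fun _ _ _ => ∅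

variable {P : Plan n} {v : Fin n → Bool}

lemma Plan.sent_zero (hP : P.Feasible v) (prot : Protocol n M) (ω : Coins n) (a i : Fin n) :
    sent prot (P.adversary prot) v ω 0 a i
      = {m | ∃ x, m = firstMsg prot (P.claims (ω 0) x) (ω 0) a i} := by
  rw [sent]
  split_ifs with h
  · rfl
  · have h' : a ∉ P.start := h
    ext m
    have : ∀ x, firstMsg prot (P.claims (ω 0) x) (ω 0) a i
        = prot.message a i 0 (v a) (ω.ofParty a (0 + 1))
          fun (k : Fin 0) b => receive (sent prot (P.adversary prot) v ω k b a) := by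
      intro x
      rw [firstMsg, hP.claims_eq _ x a h' i]
      congr 1
      · funext k
        rw [show k = 0 from Subsingleton.elim (α := Fin 1) k 0]; rfl
      · funext k
        exact k.elim0
    simp only [Set.mem_singleton_iff, Set.mem_ofPred_eq, this]
    exact ⟨fun h => ⟨a, h⟩, fun ⟨_, h⟩ => h⟩

lemma Plan.receive_zero (hP : P.Feasible v) (prot : Protocol n M) (ω : Coins n) (a : Fin n)
    {i : Fin n} (hi : i ∉ P.later (ω 0)) :
    receive (sent prot (P.adversary prot) v ω 0 a i)
      = some (firstMsg prot (P.claims (ω 0) i) (ω 0) a i) := by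
  rw [P.sent_zero hP, ← receive_singleton]
  congr 1
  ext m
  have : ∀ x, firstMsg prot (P.claims (ω 0) x) (ω 0) a i
      = firstMsg prot (P.claims (ω 0) i) (ω 0) a i := fun x => by
    rw [firstMsg, hP.claims_congr _ x i hi a, ← firstMsg]
  simp only [Set.mem_singleton_iff, Set.mem_ofPred_eq, this]
  exact ⟨fun ⟨_, h⟩ => h, fun h => ⟨a, h⟩⟩

lemma ofParty_two (ω : Coins n) (a : Fin n) : ω.ofParty a (1 + 1) = ![ω 0 a, ω 1 a] := by
  funext k
  fin_cases k <;> rfl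

/-- An honest sender was told the same under the beliefs of every receiver, so one formula describes
honest and corrupted senders alike. -/
lemma Plan.sent_one (hP : P.Feasible v) (prot : Protocol n M) (ω : Coins n) (a i : Fin n) :
    sent prot (P.adversary prot) v ω 1 a i
      = {m | a ∉ P.abort (ω 0) i ∧
          m = secondMsg prot (P.claims (ω 0) i) (ω 0) (ω 1) a i} := by
  rw [sent]
  split_ifs with h
  · rfl
  · have h' : a ∉ P.later (ω 0) := h
    have h1 : a ∉ P.abort (ω 0) i := fun h2 => h' (hP.abort_subset _ _ h2)
    have h2 : a ∉ P.start := fun h2 => h' (P.start_subset _ h2)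
    ext m
    simp only [Set.mem_singleton_iff, Set.mem_ofPred_eq, h1, not_false_eq_true, true_and]
    rw [secondMsg, hP.claims_eq _ i a h2, ofParty_two]
    have : (fun (k : Fin 1) b => receive (sent prot (P.adversary prot) v ω k b a))
        = fun _ b => some (firstMsg prot (P.claims (ω 0) i) (ω 0) b a) := by
      funext k b
      rw [show k = 0 from Subsingleton.elim (α := Fin 1) k 0]
      refine (P.receive_zero hP prot ω b h').trans ?_
      rw [firstMsg, ← hP.claims_congr _ i a h', ← firstMsg]
    rw [this]

lemma Plan.receive_one (hP : P.Feasible v) (prot : Protocol n M) (ω : Coins n) (a i : Fin n) :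
    receive (sent prot (P.adversary prot) v ω 1 a i)
      = if a ∈ P.abort (ω 0) i then none
        else some (secondMsg prot (P.claims (ω 0) i) (ω 0) (ω 1) a i) := by
  rw [P.sent_one hP]
  split_ifs with h
  · rw [← receive_empty]
    congr 1
    ext m
    simp [h]
  · rw [← receive_singleton]
    congr 1
    ext m
    simp [h]

lemma Plan.locallyConsistent (hP : P.Feasible v) (prot : Protocol n M) :
    LocallyConsistent prot (P.adversary prot) v := by
  intro ω j a i _ m hm
  match j with
  | 0 =>
    obtain ⟨x, rfl⟩ : ∃ x, m = firstMsg prot (P.claims (ω 0) x) (ω 0) a i := hm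
    refine ⟨P.claims (ω 0) x a i, fun k => k.elim0, fun k => k.elim0, ?_⟩
    rw [firstMsg]
    congr 1
    funext k
    rw [show k = 0 from Subsingleton.elim (α := Fin 1) k 0]; rfl
  | 1 =>
    obtain ⟨-, rfl⟩ : a ∉ P.abort (ω 0) i ∧
      m = secondMsg prot (P.claims (ω 0) i) (ω 0) (ω 1) a i := hm
    refine ⟨P.claims (ω 0) i a a,
      fun _ b => some (firstMsg prot (P.claims (ω 0) i) (ω 0) b a), ?_, ?_⟩
    · intro k b x hx
      rw [show k = 0 from Subsingleton.elim (α := Fin 1) k 0]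
      rw [Option.mem_some_iff] at hx
      refine (P.sent_zero hP prot ω b a).symm ▸ ⟨i, hx.symm⟩
    · rw [ofParty_two]; rfl
  | j + 2 => exact absurd hm (Set.notMem_empty m)

lemma Plan.corruptsAtMost {t : ℕ} (hP : ∀ r, (P.later r).card ≤ t) (prot : Protocol n M) :
    (P.adversary prot).CorruptsAtMost t := by
  intro ω j
  cases j with
  | zero => exact (Finset.card_le_card (P.start_subset (ω 0))).trans (hP _)
  | succ j => exact hP _

lemma Plan.honest_iff (prot : Protocol n M) (ω : Coins n) (i : Fin n) :
    Honest (P.adversary prot) ω i ↔ i ∉ P.later (ω 0) := by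
  refine ⟨fun h => h 1, fun h j => ?_⟩
  cases j with
  | zero => exact fun h' => h (P.start_subset _ h')
  | succ j => exact h

lemma Plan.decision_zero (hP : P.Feasible v) (prot : Protocol n M) (ω : Coins n) {i : Fin n}
    (hi : i ∉ P.later (ω 0)) :
    decision prot (P.adversary prot) v ω 0 i
      = firstDecision prot (P.claims (ω 0) i) i (ω 0) := by
  rw [decision, firstDecision, hP.claims_eq _ i i fun h => hi (P.start_subset _ h)]
  congr 1
  · funext k
    rw [show k = 0 from Subsingleton.elim (α := Fin 1) k 0]; rfl
  · funext k a
    rw [show k = 0 from Subsingleton.elim (α := Fin 1) k 0]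
    exact P.receive_zero hP prot ω a hi

lemma Plan.decision_one (hP : P.Feasible v) (prot : Protocol n M) (ω : Coins n) {i : Fin n}
    (hi : i ∉ P.later (ω 0)) :
    decision prot (P.adversary prot) v ω 1 i
      = secondDecision prot (P.claims (ω 0) i) (P.abort (ω 0) i) i (ω 0) (ω 1) := by
  rw [decision, secondDecision, hP.claims_eq _ i i fun h => hi (P.start_subset _ h), ofParty_two]
  congr 1
  funext k a
  fin_cases k
  · exact P.receive_zero hP prot ω a hi
  · exact P.receive_one hP prot ω a i

lemma Plan.haltsWithin_two_iff (hP : P.Feasible v) (prot : Protocol n M) (ω : Coins n) {i : Fin n}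
    (hi : i ∉ P.later (ω 0)) :
    HaltsWithin prot (P.adversary prot) v ω 2 i ↔
      earlyOutput prot (P.claims (ω 0) i) (P.abort (ω 0) i) i (ω 0) (ω 1) ≠ none := by
  rw [earlyOutput, ← P.decision_zero hP prot ω hi, ← P.decision_one hP prot ω hi, ne_eq,
    Option.or_eq_none_iff, not_and_or]
  constructor
  · rintro ⟨j, hj, h⟩
    interval_cases j
    · exact Or.inl h
    · exact Or.inr h
  · rintro (h | h)
    · exact ⟨0, by norm_num, h⟩
    · exact ⟨1, by norm_num, h⟩

lemma Plan.eq_of_outputs (hP : P.Feasible v) (prot : Protocol n M) (ω : Coins n) {i : Fin n}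
    (hi : i ∉ P.later (ω 0)) {b b' : Bool} (h : Outputs prot (P.adversary prot) v ω i b)
    (h' : earlyOutput prot (P.claims (ω 0) i) (P.abort (ω 0) i) i (ω 0) (ω 1) = some b') :
    b = b' := by
  rw [earlyOutput, ← P.decision_zero hP prot ω hi, ← P.decision_one hP prot ω hi,
    Option.or_eq_some_iff] at h'
  obtain ⟨j, hj, hlt⟩ := h
  have hfirst : ∀ k, decision prot (P.adversary prot) v ω k i = some b' →
      (∀ l < k, decision prot (P.adversary prot) v ω l i = none) → b = b' := by
    intro k hk hkl
    rcases lt_trichotomy j k with h | rfl | h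
    · rw [hkl j h] at hj; simp at hj
    · rw [hj] at hk; simpa using hk
    · rw [hlt k h] at hk; simp at hk
  rcases h' with h' | ⟨h0, h1⟩
  · exact hfirst 0 h' fun l hl => absurd hl (Nat.not_lt_zero l)
  · exact hfirst 1 h1 fun l hl => by rw [Nat.lt_one_iff.1 hl]; exact h0

end Attack

/-! ### The coins of the first two rounds. -/

section Measure

variable {n : ℕ}

instance (n : ℕ) : IsProbabilityMeasure (coinMeasure n) := by
  unfold coinMeasure
  infer_instance

lemma coinMeasure_cylinder (r r' : Fin n → Bool) :
    coinMeasure n {ω | ω 0 = r ∧ ω 1 = r'}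
      = (Fintype.card (Fin n → Bool) : ENNReal)⁻¹ * (Fintype.card (Fin n → Bool) : ENNReal)⁻¹ := by
  have h : {ω : Coins n | ω 0 = r ∧ ω 1 = r'}
      = Set.pi ((Finset.range 2 : Finset ℕ) : Set ℕ) fun j => {if j = 0 then r else r'} := by
    ext ω
    simp [Finset.range_add_one, and_comm]
  rw [h, coinMeasure, Measure.infinitePi_pi _ fun _ _ => MeasurableSet.singleton _,
    Finset.prod_range_succ, Finset.prod_range_one]
  rw [PMF.toMeasure_apply_singleton _ _ (MeasurableSet.singleton _),
    PMF.toMeasure_apply_singleton _ _ (MeasurableSet.singleton _)]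
  simp

/-- Prescribing two rounds of coins is an event of positive probability. This makes almost sure
agreement and validity usable at every pair of coin vectors. -/
lemma exists_coins_of_ae {p : Coins n → Prop} (h : ∀ᵐ ω ∂coinMeasure n, p ω) (r r' : Fin n → Bool) :
    ∃ ω, p ω ∧ ω 0 = r ∧ ω 1 = r' := by
  have h0 : coinMeasure n {ω | ω 0 = r ∧ ω 1 = r'} ≠ 0 := by
    rw [coinMeasure_cylinder]
    simp
  by_contra! hne
  refine h0 (measure_mono_null (fun ω hω => ?_) (ae_iff.1 h))
  exact fun hp => hne ω hp hω.1 hω.2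

open scoped BigOperators in
lemma coinMeasure_real_le (Q : (Fin n → Bool) → Set (Fin n → Bool)) :
    (coinMeasure n).real {ω | ω 1 ∈ Q (ω 0)} ≤ 𝔼 r, BooleanCube.density (Q r) := by
  classical
  set I : Finset ((Fin n → Bool) × (Fin n → Bool)) := Finset.univ.filter fun p => p.2 ∈ Q p.1
  have h1 : {ω : Coins n | ω 1 ∈ Q (ω 0)} ⊆ ⋃ p ∈ I, {ω : Coins n | ω 0 = p.1 ∧ ω 1 = p.2} := by
    intro ω hω
    simp only [Set.mem_iUnion]
    exact ⟨(ω 0, ω 1), by simpa [I] using hω, rfl, rfl⟩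
  refine (measureReal_mono h1 (measure_ne_top _ _)).trans
    ((measureReal_biUnion_finset_le _ _).trans (le_of_eq ?_))
  simp only [Measure.real, coinMeasure_cylinder]
  rw [Finset.sum_filter, ← Finset.univ_product_univ, Finset.sum_product,
    Fintype.expect_eq_sum_div_card, Finset.sum_div]
  refine Finset.sum_congr rfl fun r _ => ?_
  rw [BooleanCube.density, Fintype.expect_eq_sum_div_card, div_div, Finset.sum_div]
  refine Finset.sum_congr rfl fun r' _ => ?_
  by_cases h : r' ∈ Q r <;> simp [h]

end Measure

end ByzantineAgreement
-- The hybrid argument and the bound on halting.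
namespace ByzantineAgreement

section Bound

open scoped BigOperators
open BooleanCube

variable {n : ℕ} {M : Type*} {prot : Protocol n M} {t : ℕ}

/-- One attack can show p and q different claims and different aborts, as long as the claims differ
only in what is told to C ∪ T. -/
lemma PerfectAgreement.earlyOutput_eq (h : PerfectAgreement prot t) {v : Fin n → Bool}
    {C T T₁ T₂ : Finset (Fin n)} {w₁ w₂ : Fin n → Fin n → Bool}
    (hw₁ : ∀ a ∉ C, ∀ i, w₁ a i = v a) (hw₂ : ∀ a ∉ C, ∀ i, w₂ a i = v a)
    (hw : ∀ i ∉ C ∪ T, ∀ a, w₁ a i = w₂ a i) (hT₁ : T₁ ⊆ T) (hT₂ : T₂ ⊆ T)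
    (ht : (C ∪ T).card ≤ t) {p q : Fin n} (hpq : p ≠ q) (hp : p ∉ C ∪ T) (hq : q ∉ C ∪ T)
    {r x : Fin n → Bool} {b₁ b₂ : Bool} (h₁ : earlyOutput prot w₁ T₁ p r x = some b₁)
    (h₂ : earlyOutput prot w₂ T₂ q r x = some b₂) : b₁ = b₂ := by
  let P : Plan n :=
    { start := C
      later := fun _ => C ∪ T
      start_subset := fun _ => Finset.subset_union_left
      claims := fun _ i => if i = q then w₂ else w₁
      abort := fun _ i => if i = q then T₂ else T₁ }
  have hP : P.Feasible v :=
    { claims_eq := fun _ i a ha j => by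
        by_cases hi : i = q
        · simpa [P, hi] using hw₂ a ha j
        · simpa [P, hi] using hw₁ a ha j
      claims_congr := fun _ i j hj a => by
        have := hw j hj a
        by_cases hi : i = q <;> by_cases hj : j = q <;> simp_all [P]
      abort_subset := fun _ i => by
        by_cases hi : i = q
        · simpa [P, hi] using hT₂.trans Finset.subset_union_right
        · simpa [P, hi] using hT₁.trans Finset.subset_union_right }
  obtain ⟨ω, ⟨b, hb⟩, rfl, rfl⟩ := exists_coins_of_ae
    (h v (P.adversary prot) (P.locallyConsistent hP prot) (P.corruptsAtMost (fun _ => ht) prot)) r x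
  have e₁ := P.eq_of_outputs hP prot ω hp (hb p ((P.honest_iff prot ω p).2 hp))
    (b' := b₁) (by simpa [P, hpq] using h₁)
  have e₂ := P.eq_of_outputs hP prot ω hq (hb q ((P.honest_iff prot ω q).2 hq))
    (b' := b₂) (by simpa [P] using h₂)
  rw [← e₁, ← e₂]

lemma PerfectValidity.earlyOutput_eq (h : PerfectValidity prot t) {v : Fin n → Bool}
    {D : Finset (Fin n)} (hD : D.card ≤ t) {b b' : Bool} (hv : ∀ i ∉ D, v i = b) {p : Fin n}
    (hp : p ∉ D) {r x : Fin n → Bool}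
    (h' : earlyOutput prot (fun a _ => v a) ∅ p r x = some b') : b = b' := by
  -- The parties in D are formally corrupted but behave honestly with their inputs in v, so only the
  -- inputs outside D matter for validity.
  let P : Plan n :=
    { start := D
      later := fun _ => D
      start_subset := fun _ => subset_rfl
      claims := fun _ _ a _ => v a
      abort := fun _ _ => ∅ }
  have hP : P.Feasible v := ⟨fun _ _ _ _ _ => rfl, fun _ _ _ _ _ => rfl, fun _ _ => by simp [P]⟩
  obtain ⟨ω, hb, rfl, rfl⟩ := exists_coins_of_ae
    (h v (P.adversary prot) (P.locallyConsistent hP prot) (P.corruptsAtMost (fun _ => hD) prot)) r x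
  exact P.eq_of_outputs hP prot ω hp
    (hb b (fun i hi => hv i ((P.honest_iff prot ω i).1 hi)) p ((P.honest_iff prot ω p).2 hp)) h'

/-- The adversary can wait for the coins of the first round to choose the claims of the parties in
`C`, and the parties `T` that will abort in the second round. -/
lemma HasHalting.exists_first_coins {γ : ℝ} (h : HasHalting prot t 2 γ) (v : Fin n → Bool)
    (C : Finset (Fin n)) {m : ℕ} (ht : C.card + m ≤ t) :
    ∃ r, ∀ w : Fin n → Fin n → Bool, (∀ a ∉ C, ∀ i, w a i = v a) →
      ∀ T : Finset (Fin n), T.card ≤ m →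
        γ ≤ density {x | ∀ i ∉ C ∪ T, earlyOutput prot w T i r x ≠ none} := by
  by_contra! hne
  choose w hw T hT hlt using hne
  let P : Plan n :=
    { start := C
      later := fun r => C ∪ T r
      start_subset := fun _ => Finset.subset_union_left
      claims := fun r _ => w r
      abort := fun r _ => T r }
  have hP : P.Feasible v :=
    ⟨fun r _ a ha i => hw r a ha i, fun _ _ _ _ _ => rfl, fun _ _ => Finset.subset_union_right⟩
  have h1 := h v (P.adversary prot) (P.locallyConsistent hP prot)
    (P.corruptsAtMost (fun r => (Finset.card_union_le _ _).trans (by have := hT r; omega)) prot)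
  let Q : (Fin n → Bool) → Set (Fin n → Bool) := fun r =>
    {x | ∀ i ∉ C ∪ T r, earlyOutput prot (w r) (T r) i r x ≠ none}
  have h2 : {ω | ∀ i, Honest (P.adversary prot) ω i → HaltsWithin prot (P.adversary prot) v ω 2 i}
      ⊆ {ω | ω 1 ∈ Q (ω 0)} := fun ω hω i hi =>
    (P.haltsWithin_two_iff hP prot ω hi).1 (hω i ((P.honest_iff prot ω i).2 hi))
  have h3 := h1.trans ((measureReal_mono h2 (measure_ne_top _ _)).trans (coinMeasure_real_le Q))
  have h4 := Finset.expect_lt_expect (s := Finset.univ) (fun r _ => (hlt r).le)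
    ⟨fun _ => false, Finset.mem_univ _, hlt _⟩
  rw [Fintype.expect_const] at h4
  exact h4.not_ge h3

/-- The claims when a party `a` in `C` claims the input `1` exactly towards those `i` with
`(a, i) ∈ U`. -/
def hybridClaims (C : Finset (Fin n)) (v : Fin n → Bool) (U : Finset (Fin n × Fin n))
    (a i : Fin n) : Bool :=
  if a ∈ C then decide ((a, i) ∈ U) else v a

lemma hybridClaims_of_notMem {C : Finset (Fin n)} (v : Fin n → Bool) (U : Finset (Fin n × Fin n)) :
    ∀ a ∉ C, ∀ i, hybridClaims C v U a i = v a := fun a ha i => by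
  simp [hybridClaims, ha]

lemma hybridClaims_insert {C : Finset (Fin n)} (v : Fin n → Bool) (U : Finset (Fin n × Fin n))
    (e : Fin n × Fin n) {i : Fin n} (hi : i ≠ e.2) (a : Fin n) :
    hybridClaims C v U a i = hybridClaims C v (insert e U) a i := by
  have : (a, i) ≠ e := fun h => hi (by rw [← h])
  simp [hybridClaims, this]

/-- If small coalitions control all sets of density at least `δ / 2` up to `δ / 3`, then the
second-round halting probability is at most `δ`. -/
theorem halting_le_of_coalition {γ δ : ℝ} (hδ : 0 < δ) {k : ℕ}
    (hcoal : ∀ E : Set (Fin n → Bool), δ / 2 ≤ density E →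
      ∃ S : Finset (Fin n), S.card ≤ k ∧ 1 - δ / 3 ≤ density (reach S E))
    {A B C : Finset (Fin n)} (hABC : ∀ i, i ∈ A ∨ i ∈ B ∨ i ∈ C)
    {p₀ q₀ : Fin n} (hp₀B : p₀ ∉ B) (hp₀C : p₀ ∉ C) (hq₀A : q₀ ∉ A) (hq₀C : q₀ ∉ C)
    (hA : A.card ≤ t) (hB : B.card ≤ t) (hC : C.card + (2 * k + 1) ≤ t)
    (hn : C.card + (2 * k + 1) + 2 ≤ n) (hprot : IsSuperb prot t) (hγ : HasHalting prot t 2 γ) :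
    γ ≤ δ := by
  by_contra! hlt
  obtain ⟨hagr, hval⟩ := hprot
  -- The inputs on C are immaterial, as `hybridClaims` overrides them.
  set v : Fin n → Bool := fun i => decide (i ∈ B) with hv
  obtain ⟨r, hr⟩ := hγ.exists_first_coins v C hC
  let w := hybridClaims C v
  have hw : ∀ U, ∀ a ∉ C, ∀ i, w U a i = v a := hybridClaims_of_notMem v
  let X : Bool → Finset (Fin n × Fin n) → Set (Fin n → Bool) := fun b U =>
    {x | ∀ i ∉ C, earlyOutput prot (w U) ∅ i r x = some b}
  have hsum : ∀ U, γ ≤ density (X false U) + density (X true U) := by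
    intro U
    refine (hr (w U) (hw U) ∅ (by simp)).trans
      ((density_mono fun x hx => ?_).trans (density_union_le _ _))
    rw [Finset.union_empty] at hx
    obtain ⟨b, hb⟩ := Option.ne_none_iff_exists'.1 (hx p₀ hp₀C)
    have hmem : x ∈ X b U := by
      intro i hi
      obtain ⟨b', hb'⟩ := Option.ne_none_iff_exists'.1 (hx i hi)
      by_cases hip : i = p₀
      · rw [hip]; exact hb
      · rw [hb', hagr.earlyOutput_eq (hw U) (hw U) (fun _ _ _ => rfl) subset_rfl subset_rfl
          (by rw [Finset.union_empty]; omega) hip (by simpa using hi) (by simpa using hp₀C) hb' hb]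
    cases b
    · exact Or.inl hmem
    · exact Or.inr hmem
  -- The same messages arise when C really has input 0, and then all parties outside B share the
  -- input 0.
  have hbot : X true ∅ = ∅ := by
    refine Set.eq_empty_of_forall_notMem fun x hx => ?_
    have hw₀ : w ∅ = fun a _ => if a ∈ C then false else v a := by
      funext a i
      simp [w, hybridClaims]
    have h := hx p₀ hp₀C
    rw [hw₀] at h
    refine Bool.false_ne_true (hval.earlyOutput_eq hB (fun i hi => ?_) hp₀B h)
    by_cases hiC : i ∈ C <;> simp [hv, hi, hiC]
  have htop : X false Finset.univ = ∅ := by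
    refine Set.eq_empty_of_forall_notMem fun x hx => ?_
    have hw₀ : w Finset.univ = fun a _ => if a ∈ C then true else v a := by
      funext a i
      simp [w, hybridClaims]
    have h := hx q₀ hq₀C
    rw [hw₀] at h
    refine Bool.false_ne_true.symm (hval.earlyOutput_eq hA (fun i hi => ?_) hq₀A h)
    rcases hABC i with hiA | hiB | hiC
    · exact absurd hiA hi
    · by_cases hiC : i ∈ C <;> simp [hv, hiB]
    · simp [hiC]
  -- The density of output 0 is at least γ at the empty set and zero at the full set, so some
  -- insertion crosses γ/2.
  obtain ⟨U, e, hU, hU'⟩ : ∃ U e, γ / 2 ≤ density (X false U) ∧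
      density (X false (insert e U)) < γ / 2 := by
    by_contra! hstep
    have hall : ∀ U, γ / 2 ≤ density (X false U) := by
      intro U
      induction U using Finset.induction_on with
      | empty =>
        have := hsum ∅
        rw [hbot, density_empty] at this
        linarith
      | insert e U _ ih => exact hstep U e ih
    have := hall Finset.univ
    rw [htop, density_empty] at this
    linarith
  have hU'' : γ / 2 ≤ density (X true (insert e U)) := by linarith [hsum (insert e U)]
  obtain ⟨S, hSk, hS⟩ := hcoal (X false U) (by linarith)
  obtain ⟨S', hSk', hS'⟩ := hcoal (X true (insert e U)) (by linarith)
  -- The party `e.2` is the only one that hears the difference between the two claims; as a member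
  -- of T it can pretend either version.
  set T := insert e.2 (S ∪ S') with hT
  have hTk : T.card ≤ 2 * k + 1 := by
    have h1 := Finset.card_insert_le e.2 (S ∪ S')
    have h2 := Finset.card_union_le S S'
    rw [hT]
    omega
  have hST : S ⊆ T := Finset.subset_union_left.trans (Finset.subset_insert _ _)
  have hST' : S' ⊆ T := Finset.subset_union_right.trans (Finset.subset_insert _ _)
  have hCT : (C ∪ T).card ≤ C.card + (2 * k + 1) := (Finset.card_union_le _ _).trans (by omega)
  -- The densities exceed δ, 1 - δ/3 and 1 - δ/3 in sum, hence 2.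
  obtain ⟨x, hx, ⟨z, hz, hzx⟩, z', hz', hzx'⟩ := exists_mem_of_density
    (A := {x | ∀ i ∉ C ∪ T, earlyOutput prot (w U) T i r x ≠ none}) (B := reach S (X false U))
    (C := reach S' (X true (insert e U))) (by linarith [hr (w U) (hw U) T hTk])
  have htwo : 1 < (C ∪ T)ᶜ.card := by
    rw [Finset.card_compl, Fintype.card_fin]
    omega
  obtain ⟨p, hp, q, hq, hpq⟩ := Finset.one_lt_card.1 htwo
  rw [Finset.mem_compl] at hp hq
  have hpT : p ∉ T := fun h => hp (Finset.mem_union_right _ h)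
  have hqC : q ∉ C := fun h => hq (Finset.mem_union_left _ h)
  obtain ⟨b, hb⟩ := Option.ne_none_iff_exists'.1 (hx p hp)
  -- At the coins z, T aborts towards p but not towards q; p cannot tell z from x, and q outputs
  -- false.
  have hb₀ : b = false := by
    rw [earlyOutput_congr prot r hpT (fun _ _ _ => rfl)
      fun j hj => (hzx j fun h => hj (hST h)).symm] at hb
    exact hagr.earlyOutput_eq (hw U) (hw U) (fun _ _ _ => rfl) subset_rfl
      (Finset.empty_subset T) (hCT.trans hC) hpq hp hq hb (hz q hqC)
  have hb₁ : b = true := by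
    rw [earlyOutput_congr prot r hpT (fun _ _ _ => rfl)
      fun j hj => (hzx' j fun h => hj (hST' h)).symm] at hb
    -- Here p is shown the claims before the insertion and q those after it.
    refine hagr.earlyOutput_eq (hw U) (hw (insert e U)) (fun i hi a => ?_) subset_rfl
      (Finset.empty_subset T) (hCT.trans hC) hpq hp hq hb (hz' q hqC)
    refine hybridClaims_insert v U e (fun h => hi ?_) a
    rw [h]
    exact Finset.mem_union_right _ (Finset.mem_insert_self _ _)
  rw [hb₀] at hb₁
  exact Bool.false_ne_true hb₁

lemma card_filter_val_le (n a b : ℕ) :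
    (Finset.univ.filter fun i : Fin n => a ≤ i.val ∧ i.val < b).card ≤ b - a := by
  rw [← Nat.card_Ico]
  refine Finset.card_le_card_of_injOn Fin.val (fun i hi => ?_) Fin.val_injective.injOn
  simpa using hi

end Bound

end ByzantineAgreement

/-! ### Choice of the parameters. -/

theorem theorem2p1 :
    ∀ ε : ℝ, 0 < ε → ∃ c : ℝ, 0 < c ∧ ∃ N : ℕ, ∀ n : ℕ, N ≤ n →
      ∀ (M : Type*) (prot : ByzantineAgreement.Protocol n M),
        ByzantineAgreement.IsSuperb prot ⌊(1 / 3 + ε) * (n : ℝ)⌋₊ →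
          ∀ γ : ℝ, ByzantineAgreement.HasHalting prot ⌊(1 / 3 + ε) * (n : ℝ)⌋₊ 2 γ →
            γ ≤ (n : ℝ) ^ (-c) := by
  intro ε hε
  -- Two coalitions of size η n cost at most half of the slack ε n; the minimum with 1 leaves two
  -- honest parties even for large ε.
  set η := min ε 1 / 4 with hη
  have hη0 : 0 < η := by positivity
  have hηε : η ≤ ε / 4 := by rw [hη]; gcongr; exact min_le_left _ _
  have hη1 : η ≤ 1 / 4 := by rw [hη]; gcongr; exact min_le_right _ _
  obtain ⟨c, hc, N, hN⟩ := BooleanCube.exists_coalition hη0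
  refine ⟨c, hc, max N (max 24 ⌈4 / ε⌉₊), fun n hn M prot hprot γ hγ => ?_⟩
  have hn24 : 24 ≤ n := by omega
  have hn24' : (24 : ℝ) ≤ n := by exact_mod_cast hn24
  have hnε : 4 ≤ ε * n := by
    have h1 : 4 / ε ≤ n := (Nat.le_ceil _).trans (by exact_mod_cast (by omega : ⌈4 / ε⌉₊ ≤ n))
    rwa [div_le_iff₀ hε, mul_comm] at h1
  have hηn : η * n ≤ ε / 4 * n := mul_le_mul_of_nonneg_right hηε (by positivity)
  have hηn' : η * n ≤ 1 / 4 * n := mul_le_mul_of_nonneg_right hη1 (by positivity)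
  set m := (n + 2) / 3 with hm
  have hm3 : (m : ℝ) ≤ n / 3 + 2 / 3 := by
    have : 3 * m ≤ n + 2 := by omega
    have : (3 : ℝ) * m ≤ n + 2 := by exact_mod_cast this
    linarith
  set k := ⌊η * n⌋₊ with hk
  have hkη : (k : ℝ) ≤ η * n := Nat.floor_le (by positivity)
  have ht : m + (2 * k + 1) ≤ ⌊(1 / 3 + ε) * (n : ℝ)⌋₊ := by
    refine Nat.le_floor ?_
    push_cast
    linarith
  have hmn : m + (2 * k + 1) + 2 ≤ n := by
    have : ((m + (2 * k + 1) + 2 : ℕ) : ℝ) ≤ n := by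
      push_cast
      linarith
    exact_mod_cast this
  have hC := ByzantineAgreement.card_filter_val_le n 0 m
  have hB := ByzantineAgreement.card_filter_val_le n m (2 * m)
  have hA := ByzantineAgreement.card_filter_val_le n (2 * m) n
  refine ByzantineAgreement.halting_le_of_coalition (k := k) (by positivity) (fun E hE => ?_)
    (A := Finset.univ.filter fun i : Fin n => 2 * m ≤ i.val ∧ i.val < n)
    (B := Finset.univ.filter fun i : Fin n => m ≤ i.val ∧ i.val < 2 * m)
    (C := Finset.univ.filter fun i : Fin n => 0 ≤ i.val ∧ i.val < m)
    (fun i => ?_) (p₀ := ⟨2 * m, by omega⟩) (q₀ := ⟨m, by omega⟩) ?_ ?_ ?_ ?_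
    (by omega) (by omega) (by omega) (by omega) hprot hγ
  · obtain ⟨S, hS, h⟩ := hN n (by omega) E hE
    exact ⟨S, Nat.le_floor hS, h⟩
  · simp only [Finset.mem_filter, Finset.mem_univ, true_and]
    omega
  all_goals simp only [Finset.mem_filter, Finset.mem_univ, true_and]; omega
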